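/- Let $I=(0,1)$. For a positive weight $\rho\in L^1(I)$ let $W^{1,1}_\rho(I)$ be the space of functions $u$ on $I$ with weak derivative $u'$ such that $\int_I|u|\rho<\infty$ and $\int_I|u'|\rho<\infty$, and set $$\sigma_1(I,\rho):=\inf\Big\{\frac{\int_I|u'|\rho}{\int_I|u|\rho}\ :\ u\in W^{1,1}_\rho(I)\setminus\{0\},\ \int_I u\,\rho=0\Big\}.$$ For $m\in\mathbb N\setminus\{0\}$, a positive function $\phi$ on $I$ is called $(\frac1m)$-concave if $\phi^{1/m}$ is concave on $I$. **Proposition.** For every $m\in\mathbb N\setminus\{0\}$ there exist constants $C_1=C_1(m)>0$ and $\delta_0=\delta_0(m)\in(0,\frac12)$ with the following property. Let $\rho=\phi h$ be a positive weight on $I$ with $\|\rho\|_{L^\infty(I)}=1$, where $\phi$ is positive and $(\frac1m)$-concave on $I$, and $h$ is concave on $I$ and affine on $[\delta_0,1-\delta_0]$. Then $$\sigma_1(I,\rho)\le\frac52\quad\Longrightarrow\quad \sigma_1(I,\rho)\ \ge\ 2+C_1\min_{[\delta_0,1-\delta_0]}\Big(\frac{h'}{h}\Big)^2 ,$$ where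 $h'$ at the endpoints of $[\delta_0,1-\delta_0]$ is the one-sided derivative from inside the interval. -/

import Mathlib

open MeasureTheory Set
open scoped ContDiff

noncomputable section

/-- `f` is positive on `s` and `f ^ (1 / m)` is concave on `s`. -/
def IsPositivePowerConcaveOn (m : ℕ) (s : Set ℝ) (f : ℝ → ℝ) : Prop :=
  (∀ x ∈ s, 0 < f x) ∧ ConcaveOn ℝ s (fun x => f x ^ (1 / (m : ℝ)))

/-- `f` coincides with an affine function on `s`. -/
def IsAffineOn (s : Set ℝ) (f : ℝ → ℝ) : Prop :=
  ∃ a b : ℝ, ∀ x ∈ s, f x = a * x + b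

/-- `g` is the weak derivative of `u` on the open set `I`, tested against `C_c^∞(I)`. -/
def IsWeakDerivOn (I : Set ℝ) (u g : ℝ → ℝ) : Prop :=
  LocallyIntegrableOn u I volume ∧ LocallyIntegrableOn g I volume ∧
    ∀ ψ : ℝ → ℝ, ContDiff ℝ ∞ ψ → HasCompactSupport ψ → tsupport ψ ⊆ I →
      ∫ x in I, u x * deriv ψ x = -∫ x in I, g x * ψ x

/-- `u` belongs to the weighted Sobolev space `W^{1,1}_ρ(I)`, with weak derivative `g`. -/
def MemWeightedSobolev (I : Set ℝ) (ρ u g : ℝ → ℝ) : Prop :=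
  IsWeakDerivOn I u g ∧
    IntegrableOn (fun x => u x * ρ x) I volume ∧
    IntegrableOn (fun x => g x * ρ x) I volume

/-- `u` is a nonzero element of `W^{1,1}_ρ(I)`, with weak derivative `g` and `∫_I u ρ = 0`. -/
def IsCompetitor (I : Set ℝ) (ρ u g : ℝ → ℝ) : Prop :=
  MemWeightedSobolev I ρ u g ∧
    ∫ x in I, u x * ρ x = 0 ∧
    0 < ∫ x in I, |u x| * ρ x

/-- The inverse weighted Poincaré constant `σ₁(I, ρ)`: the infimum of
`∫_I |u'| ρ / ∫_I |u| ρ` over nonzero `u ∈ W^{1,1}_ρ(I)` with `∫_I u ρ = 0`.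
It is taken in the extended reals, so that no convention for real infima intervenes. -/
def sigmaOne (I : Set ℝ) (ρ : ℝ → ℝ) : EReal :=
  ⨅ (u : ℝ → ℝ) (g : ℝ → ℝ) (_ : IsCompetitor I ρ u g),
    (((∫ x in I, |g x| * ρ x) / (∫ x in I, |u x| * ρ x) : ℝ) : EReal)

end

/-! Write `P` for the total mass and `A(t)`, `B(t)` for the masses left and right of `t`. If `u` has
zero mean, then `P u(x) = ∫ (u(x) - u(z)) ρ(z) dz`. Bounding `|u(x) - u(z)|` by the integral of
`|u'|` between `x` and `z` and applying Fubini gives `P ∫ |u| ρ ≤ 2 ∫ |u'| A B`. So a lower bound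
`M` for `σ₁` follows from the half-interval inequality `2 M A B ≤ ρ(t) P`, that is, `ρ(t) (1/A +
1/B) ≥ 2 M` (`IsCompetitor.mul_integral_abs_le`).

Both factors of `ρ` lie below exponentials touching them at `t`, so `ρ(x) ≤ ρ(t) exp(k (x - t))`.
This reduces the case `M = 2` to a pure exponential, where the sum of reciprocal masses is at least
`4` and at least `|k|` (`harmonic_setIntegral_exp`).

The improvement comes from the affine piece of `h`: there `(log h)'' = -(h'/h)² ≤ -c`, which adds a
Gaussian factor `exp(-c (x - t)² / 4)` to the majorant (`affine_le_mul_exp`). For `t` in the middle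
this removes mass of order `c` from one side (`harmonic_gain`). For `t` near an endpoint, or for a
steep exponential, the reciprocal sum is already at least `5`. The exponent `m` affects only the
slope `k`, so the constants do not depend on it. -/

/-! ### Weak derivatives on an interval: representation by a primitive. -/

theorem exists_Ioo_superset_of_isCompact_subset_Ioo {a b : ℝ} {K : Set ℝ} (hK : IsCompact K)
    (hne : K.Nonempty) (hKI : K ⊆ Ioo a b) :
    ∃ p q, a < p ∧ q < b ∧ K ⊆ Ioo p q := by
  obtain ⟨x, hx, hxmin⟩ := hK.exists_isLeast hne
  obtain ⟨y, hy, hymax⟩ := hK.exists_isGreatest hne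
  obtain ⟨p, hp₁, hp₂⟩ := exists_between (hKI hx).1
  obtain ⟨q, hq₁, hq₂⟩ := exists_between (hKI hy).2
  exact ⟨p, q, hp₁, hq₂, fun z hz => ⟨hp₂.trans_le (hxmin hz), (hymax hz).trans_lt hq₁⟩⟩

theorem exists_contDiff_primitive {θ : ℝ → ℝ} {p q : ℝ} (hθ : ContDiff ℝ ∞ θ)
    (hsupp : Function.support θ ⊆ Ioo p q) (hint : ∫ x, θ x = 0) :
    ∃ ψ : ℝ → ℝ, ContDiff ℝ ∞ ψ ∧ tsupport ψ ⊆ Icc p q ∧ deriv ψ = θ := by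
  have hderiv : ∀ x, HasDerivAt (fun x => ∫ y in p..x, θ y) (θ x) x := fun x =>
    (hθ.continuous.integral_hasStrictDerivAt p x).hasDerivAt
  have hd : deriv (fun x => ∫ y in p..x, θ y) = θ := funext fun x => (hderiv x).deriv
  have hzero : ∀ x ∉ Ioo p q, θ x = 0 := fun x hx => by
    by_contra hne
    exact hx (hsupp hne)
  refine ⟨fun x => ∫ y in p..x, θ y, ?_, ?_, hd⟩
  · rw [contDiff_infty_iff_deriv, hd]
    exact ⟨fun x => (hderiv x).differentiableAt, hθ⟩
  · refine closure_minimal (fun x hx => ?_) isClosed_Icc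
    by_contra hxI
    apply hx
    rcases le_total x p with hxp | hxp
    · show ∫ y in p..x, θ y = 0
      rw [intervalIntegral.integral_zero_ae]
      filter_upwards with y hy
      rw [uIoc_of_ge hxp] at hy
      exact hzero y fun h => absurd hy.2 (not_le.2 h.1)
    · have hqx : q < x := by
        by_contra hle
        exact hxI ⟨hxp, not_lt.1 hle⟩
      show ∫ y in p..x, θ y = 0
      rw [intervalIntegral.integral_of_le hxp, setIntegral_eq_integral_of_forall_compl_eq_zero, hint]
      intro y hy
      exact hzero y fun h => hy ⟨h.1, h.2.le.trans hqx.le⟩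

theorem intervalIntegrable_of_locallyIntegrableOn_Ioo {g : ℝ → ℝ} {a b p q : ℝ}
    (hg : LocallyIntegrableOn g (Ioo a b) volume) (hp : p ∈ Ioo a b) (hq : q ∈ Ioo a b) :
    IntervalIntegrable g volume p q :=
  (hg.integrableOn_compact_subset (ordConnected_Ioo.uIcc_subset hp hq)
    isCompact_uIcc).intervalIntegrable

theorem setIntegral_Ioo_eq_intervalIntegral {f : ℝ → ℝ} {a b p q : ℝ} (hap : a < p) (hpq : p ≤ q)
    (hqb : q < b) (hf : ∀ x ∉ Ioo p q, f x = 0) :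
    ∫ x in Ioo a b, f x = ∫ x in p..q, f x := by
  rw [intervalIntegral.integral_of_le hpq, setIntegral_eq_integral_of_forall_compl_eq_zero,
    setIntegral_eq_integral_of_forall_compl_eq_zero]
  · exact fun x hx => hf x fun h => hx (Ioo_subset_Ioc_self h)
  · exact fun x hx => hf x fun h => hx (Ioo_subset_Ioo hap.le hqb.le h)

theorem integral_primitive_mul_deriv {g ψ : ℝ → ℝ} {a b x₀ : ℝ} (hx₀ : x₀ ∈ Ioo a b)
    (hg : LocallyIntegrableOn g (Ioo a b) volume) (hψ : ContDiff ℝ ∞ ψ)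
    (hc : HasCompactSupport ψ) (hs : tsupport ψ ⊆ Ioo a b) :
    ∫ x in Ioo a b, (∫ y in x₀..x, g y) * deriv ψ x = -∫ x in Ioo a b, g x * ψ x := by
  -- The base point `x₀` is added to the support so that one compact subinterval contains both;
  -- integration by parts for absolutely continuous functions applies there.
  obtain ⟨p, q, hap, hqb, hK⟩ := exists_Ioo_superset_of_isCompact_subset_Ioo
    (hc.isCompact.insert x₀) (insert_nonempty _ _) (insert_subset hx₀ hs)
  have hx₀' : x₀ ∈ Ioo p q := hK (mem_insert _ _)
  have hpq : p < q := hx₀'.1.trans hx₀'.2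
  have hsupp : tsupport ψ ⊆ Ioo p q := (subset_insert _ _).trans hK
  have hψ0 : ∀ x ∉ Ioo p q, ψ x = 0 := fun x hx =>
    image_eq_zero_of_notMem_tsupport fun h => hx (hsupp h)
  have hψ'0 : ∀ x ∉ Ioo p q, deriv ψ x = 0 := fun x hx => by
    by_contra h
    exact hx (hsupp (support_deriv_subset h))
  have hgi : IntervalIntegrable g volume p q :=
    intervalIntegrable_of_locallyIntegrableOn_Ioo hg ⟨hap, hpq.trans hqb⟩ ⟨hap.trans hpq, hqb⟩
  have hV := hgi.absolutelyContinuousOnInterval_intervalIntegral (c := x₀)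
    (by rw [uIcc_of_le hpq.le]; exact Ioo_subset_Icc_self hx₀')
  have hψa : AbsolutelyContinuousOnInterval ψ p q :=
    (hψ.of_le (by simp)).contDiffOn.absolutelyContinuousOnInterval
  rw [setIntegral_Ioo_eq_intervalIntegral hap hpq.le hqb fun x hx => by rw [hψ'0 x hx, mul_zero],
    setIntegral_Ioo_eq_intervalIntegral hap hpq.le hqb fun x hx => by rw [hψ0 x hx, mul_zero],
    hV.integral_mul_deriv_eq_deriv_mul hψa, hψ0 p (by simp), hψ0 q (by simp)]
  simp only [mul_zero, sub_zero, zero_sub, neg_inj]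
  refine intervalIntegral.integral_congr_ae ?_
  filter_upwards [hgi.ae_hasDerivAt_integral] with x hx hxm
  rw [(hx (uIoc_subset_uIcc hxm) x₀
    (by rw [uIcc_of_le hpq.le]; exact Ioo_subset_Icc_self hx₀')).deriv]

/-- A locally integrable function with vanishing weak derivative is almost everywhere constant. -/
theorem ae_eq_const_of_integral_mul_deriv_eq_zero {w : ℝ → ℝ} {a b : ℝ} (hab : a < b)
    (hw : LocallyIntegrableOn w (Ioo a b) volume)
    (h : ∀ ψ : ℝ → ℝ, ContDiff ℝ ∞ ψ → HasCompactSupport ψ → tsupport ψ ⊆ Ioo a b →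
      ∫ x in Ioo a b, w x * deriv ψ x = 0) :
    ∃ c, ∀ᵐ x, x ∈ Ioo a b → w x = c := by
  let η₀ : ContDiffBump ((a + b) / 2) :=
    ⟨(b - a) / 8, (b - a) / 4, by linarith, by linarith⟩
  let η : ℝ → ℝ := η₀.normed volume
  have hη : ContDiff ℝ ∞ η := η₀.contDiff_normed
  have hηc : HasCompactSupport η := η₀.hasCompactSupport_normed
  have hηs : tsupport η ⊆ Ioo a b := by
    show tsupport (η₀.normed volume) ⊆ _
    rw [η₀.tsupport_normed_eq, Real.closedBall_eq_Icc]
    show Icc ((a + b) / 2 - (b - a) / 4) ((a + b) / 2 + (b - a) / 4) ⊆ _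
    exact Icc_subset_Ioo (by linarith) (by linarith)
  have hηi : ∫ x, η x = 1 := η₀.integral_normed
  have hwi : ∀ f : ℝ → ℝ, Continuous f → HasCompactSupport f → tsupport f ⊆ Ioo a b →
      Integrable (fun x => f x * w x) := fun f hf hfc hfs =>
    (integrableOn_iff_integrable_of_support_subset
      (f := fun x => f x * w x) (s := tsupport f) fun x hx =>
        subset_tsupport _ (left_ne_zero_of_mul hx)).1
      ((hw.integrableOn_compact_subset hfs hfc.isCompact).continuousOn_mul
        hf.continuousOn hfc.isCompact)
  refine ⟨∫ x, η x * w x, ?_⟩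
  set c := ∫ x, η x * w x with hc
  have key := isOpen_Ioo.ae_eq_zero_of_integral_contDiff_smul_eq_zero (μ := volume)
    (f := fun x => w x - c) (hw.sub ((continuous_const.locallyIntegrable).locallyIntegrableOn _)) ?_
  · filter_upwards [key] with x hx hxI
    linarith [hx hxI]
  intro φ hφ hφc hφs
  obtain ⟨p, q, hap, hqb, hK⟩ := exists_Ioo_superset_of_isCompact_subset_Ioo
    ((hφc.isCompact.union hηc.isCompact).insert ((a + b) / 2)) (insert_nonempty _ _)
    (insert_subset ⟨by linarith, by linarith⟩ (union_subset hφs hηs))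
  have hφi : Integrable φ := hφ.continuous.integrable_of_hasCompactSupport hφc
  have hηi' : Integrable η := hη.continuous.integrable_of_hasCompactSupport hηc
  -- Subtracting `(∫ φ) η` makes the integral vanish, so the difference is the derivative of a test
  -- function.
  obtain ⟨ψ, hψ, hψs, hψd⟩ := exists_contDiff_primitive (p := p) (q := q)
    (θ := fun x => φ x - (∫ y, φ y) * η x) (hφ.sub (contDiff_const.mul hη)) (by
      intro x hx
      apply hK
      right
      by_contra hxn
      simp only [mem_union, not_or] at hxn
      exact hx (by simp [image_eq_zero_of_notMem_tsupport hxn.1,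
        image_eq_zero_of_notMem_tsupport hxn.2]))
    (by rw [integral_sub hφi (hηi'.const_mul _), integral_const_mul, hηi]; ring)
  have h0 := h ψ hψ (HasCompactSupport.of_support_subset_isCompact isCompact_Icc
    ((subset_tsupport _).trans hψs)) (hψs.trans (Icc_subset_Ioo hap hqb))
  rw [hψd, setIntegral_eq_integral_of_forall_compl_eq_zero] at h0
  · have e1 : ∀ x, w x * (φ x - (∫ y, φ y) * η x) = φ x * w x - (∫ y, φ y) * (η x * w x) :=
      fun x => by ring
    simp_rw [e1] at h0
    rw [integral_sub (hwi φ hφ.continuous hφc hφs)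
      ((hwi η hη.continuous hηc hηs).const_mul _), integral_const_mul, ← hc] at h0
    have e2 : ∀ x, φ x • (w x - c) = φ x * w x - c * φ x := fun x => by
      rw [smul_eq_mul]; ring
    simp_rw [e2]
    rw [integral_sub (hwi φ hφ.continuous hφc hφs) (hφi.const_mul _), integral_const_mul]
    linarith
  · intro x hx
    beta_reduce
    rw [image_eq_zero_of_notMem_tsupport fun hh => hx (hφs hh),
      image_eq_zero_of_notMem_tsupport fun hh => hx (hηs hh)]
    simp

theorem IsWeakDerivOn.ae_eq_const_add_integral {u g : ℝ → ℝ} {a b x₀ : ℝ} (hx₀ : x₀ ∈ Ioo a b)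
    (h : IsWeakDerivOn (Ioo a b) u g) :
    ∃ c, ∀ᵐ x, x ∈ Ioo a b → u x = c + ∫ y in x₀..x, g y := by
  obtain ⟨hu, hg, hweak⟩ := h
  have hVc : ContinuousOn (fun x => ∫ y in x₀..x, g y) (Ioo a b) := by
    intro x hx
    obtain ⟨p, q, hap, hqb, hK⟩ := exists_Ioo_superset_of_isCompact_subset_Ioo
      (isCompact_singleton.insert x₀) (insert_nonempty _ _)
      (insert_subset hx₀ (singleton_subset_iff.2 hx))
    have hx₀' : x₀ ∈ Ioo p q := hK (mem_insert _ _)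
    have hpq : p < q := hx₀'.1.trans hx₀'.2
    have hx' : x ∈ Ioo p q := hK (mem_insert_of_mem _ rfl)
    have hV := (intervalIntegrable_of_locallyIntegrableOn_Ioo hg ⟨hap, hpq.trans hqb⟩
      ⟨hap.trans hpq, hqb⟩).absolutelyContinuousOnInterval_intervalIntegral (c := x₀)
      (by rw [uIcc_of_le hpq.le]; exact Ioo_subset_Icc_self hx₀')
    exact (hV.continuousOn.continuousAt (by rw [uIcc_of_le hpq.le]
                                            exact Icc_mem_nhds hx'.1 hx'.2)).continuousWithinAt
  have hV : LocallyIntegrableOn (fun x => ∫ y in x₀..x, g y) (Ioo a b) volume :=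
    hVc.locallyIntegrableOn measurableSet_Ioo
  obtain ⟨c, hc⟩ := ae_eq_const_of_integral_mul_deriv_eq_zero (hx₀.1.trans hx₀.2) (hu.sub hV) (by
    intro ψ hψ hψc hψs
    have hint : ∀ f : ℝ → ℝ, LocallyIntegrableOn f (Ioo a b) volume →
        IntegrableOn (fun x => f x * deriv ψ x) (Ioo a b) := fun f hf =>
      ((integrableOn_iff_integrable_of_support_subset
        (f := fun x => f x * deriv ψ x) (s := tsupport ψ) fun x hx =>
          support_deriv_subset (right_ne_zero_of_mul hx)).1
        ((hf.integrableOn_compact_subset hψs hψc.isCompact).mul_continuousOn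
          (hψ.continuous_deriv (by simp)).continuousOn hψc.isCompact)).integrableOn
    simp only [Pi.sub_apply, sub_mul]
    rw [integral_sub (hint _ hu) (hint _ hV), hweak ψ hψ hψc hψs,
      integral_primitive_mul_deriv hx₀ hg hψ hψc hψs, sub_self])
  refine ⟨c, ?_⟩
  filter_upwards [hc] with x hx hxI
  have := hx hxI
  simp only [Pi.sub_apply] at this
  linarith

/-! ### From half-interval isoperimetry to the `L¹` Poincaré inequality. -/

/-- Tonelli for the indicator of `x < y ≤ z`. Matching the half-open interval with `Iio` and `Ici`
makes this exact even when the measures have atoms. -/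
theorem lintegral_lintegral_measure_Ioc (μ γ : Measure ℝ) [SFinite μ] [SFinite γ] :
    ∫⁻ x, ∫⁻ z, γ (Ioc x z) ∂μ ∂μ = ∫⁻ y, μ (Iio y) * μ (Ici y) ∂γ := by
  have hIio : Measurable fun p : ℝ × ℝ => (Iio p.2).indicator (1 : ℝ → ENNReal) p.1 :=
    measurable_one.indicator (measurableSet_lt measurable_fst measurable_snd)
  have hIci : Measurable fun p : ℝ × ℝ => (Ici p.2).indicator (1 : ℝ → ENNReal) p.1 :=
    measurable_one.indicator (measurableSet_le measurable_snd measurable_fst)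
  have hIci' : Measurable fun y => μ (Ici y) :=
    Antitone.measurable fun _ _ h => measure_mono (Ici_subset_Ici.2 h)
  have inner : ∀ x, ∫⁻ z, γ (Ioc x z) ∂μ =
      ∫⁻ y, (Iio y).indicator (1 : ℝ → ENNReal) x * μ (Ici y) ∂γ := by
    intro x
    have e : ∀ z, γ (Ioc x z) = ∫⁻ y, (Iio y).indicator (1 : ℝ → ENNReal) x *
        (Ici y).indicator (1 : ℝ → ENNReal) z ∂γ := by
      intro z
      rw [← lintegral_indicator_one measurableSet_Ioc]
      congr 1 with y
      by_cases h₁ : x < y <;> by_cases h₂ : y ≤ z <;> simp [indicator, h₁, h₂]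
    simp_rw [e]
    rw [lintegral_lintegral_swap]
    · congr 1 with y
      rw [lintegral_const_mul _ (measurable_one.indicator measurableSet_Ici),
        lintegral_indicator_one measurableSet_Ici]
    · exact ((hIio.comp (measurable_const.prodMk measurable_snd)).mul
        (hIci.comp (measurable_fst.prodMk measurable_snd))).aemeasurable
  simp_rw [inner]
  rw [lintegral_lintegral_swap]
  · congr 1 with y
    rw [lintegral_mul_const _ (measurable_one.indicator measurableSet_Iio),
      lintegral_indicator_one measurableSet_Iio]
  · exact (hIio.mul (hIci'.comp measurable_snd)).aemeasurable

theorem lintegral_lintegral_measure_uIoc_le (μ γ : Measure ℝ) [SFinite μ] [SFinite γ] :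
    ∫⁻ x, ∫⁻ z, γ (uIoc x z) ∂μ ∂μ ≤ 2 * ∫⁻ y, μ (Iio y) * μ (Ici y) ∂γ := by
  have hmeas : Measurable fun p : ℝ × ℝ => γ (Ioc p.1 p.2) := by
    have hs : MeasurableSet {p : (ℝ × ℝ) × ℝ | p.2 ∈ Ioc p.1.1 p.1.2} :=
      (measurableSet_lt measurable_fst.fst measurable_snd).inter
        (measurableSet_le measurable_snd measurable_fst.snd)
    exact measurable_measure_prodMk_left hs
  calc ∫⁻ x, ∫⁻ z, γ (uIoc x z) ∂μ ∂μ
      ≤ ∫⁻ x, ∫⁻ z, (γ (Ioc x z) + γ (Ioc z x)) ∂μ ∂μ := by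
        refine lintegral_mono fun x => lintegral_mono fun z => ?_
        rw [uIoc_eq_union]
        exact measure_union_le _ _
    _ = ∫⁻ x, (∫⁻ z, γ (Ioc x z) ∂μ + ∫⁻ z, γ (Ioc z x) ∂μ) ∂μ := by
        congr 1 with x
        exact lintegral_add_left (hmeas.comp (measurable_const.prodMk measurable_id)) _
    _ = ∫⁻ x, ∫⁻ z, γ (Ioc x z) ∂μ ∂μ + ∫⁻ x, ∫⁻ z, γ (Ioc z x) ∂μ ∂μ :=
        lintegral_add_left hmeas.lintegral_prod_right' _
    _ = 2 * ∫⁻ y, μ (Iio y) * μ (Ici y) ∂γ := by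
        rw [lintegral_lintegral_swap (f := fun x z => γ (Ioc z x))
          (hmeas.comp measurable_swap).aemeasurable, lintegral_lintegral_measure_Ioc, two_mul]

theorem IsWeakDerivOn.ae_ae_enorm_sub_le {u g : ℝ → ℝ} {a b : ℝ} (hab : a < b)
    (h : IsWeakDerivOn (Ioo a b) u g) :
    ∀ᵐ x ∂volume.restrict (Ioo a b), ∀ᵐ z ∂volume.restrict (Ioo a b),
      ‖u x - u z‖ₑ ≤ ((volume.restrict (Ioo a b)).withDensity fun y => ‖g y‖ₑ) (uIoc x z) := by
  have hx₀ : (a + b) / 2 ∈ Ioo a b := ⟨by linarith, by linarith⟩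
  obtain ⟨c, hc⟩ := h.ae_eq_const_add_integral hx₀
  rw [← ae_restrict_iff' measurableSet_Ioo] at hc
  filter_upwards [hc, ae_restrict_mem measurableSet_Ioo] with x hx hxI
  filter_upwards [hc, ae_restrict_mem measurableSet_Ioo] with z hz hzI
  have hsub : uIoc x z ⊆ Ioo a b :=
    uIoc_subset_uIcc.trans (ordConnected_Ioo.uIcc_subset hxI hzI)
  have e : u x - u z = ∫ y in z..x, g y := by
    rw [hx, hz, add_sub_add_left_eq_sub, intervalIntegral.integral_interval_sub_left
      (intervalIntegrable_of_locallyIntegrableOn_Ioo h.2.1 hx₀ hxI)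
      (intervalIntegrable_of_locallyIntegrableOn_Ioo h.2.1 hx₀ hzI)]
  have e' : ‖u x - u z‖ₑ = ‖∫ y in uIoc x z, g y‖ₑ := by
    rw [e, ← ofReal_norm, intervalIntegral.norm_integral_eq_norm_integral_uIoc, ofReal_norm,
      uIoc_comm]
  rw [e', withDensity_apply _ measurableSet_uIoc, Measure.restrict_restrict measurableSet_uIoc,
    inter_eq_self_of_subset_left hsub]
  exact enorm_integral_le_lintegral_enorm _

theorem setIntegral_Ioo_pos {ρ : ℝ → ℝ} {p q : ℝ} (hpq : p < q) (hρ : IntegrableOn ρ (Ioo p q))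
    (hpos : ∀ x ∈ Ioo p q, 0 < ρ x) : 0 < ∫ x in Ioo p q, ρ x := by
  rw [setIntegral_pos_iff_support_of_nonneg_ae _ hρ]
  · have : Function.support ρ ∩ Ioo p q = Ioo p q :=
      inter_eq_right.2 fun x hx => (hpos x hx).ne'
    simpa [this] using hpq
  · filter_upwards [ae_restrict_mem measurableSet_Ioo] with x hx using (hpos x hx).le

/-- The isoperimetric inequality for half-intervals implies the `L¹` Poincaré inequality for
functions with zero mean. -/
theorem IsCompetitor.mul_integral_abs_le {ρ u g : ℝ → ℝ} {a b M : ℝ} (hab : a < b)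
    (hρ : IntegrableOn ρ (Ioo a b)) (hpos : ∀ x ∈ Ioo a b, 0 < ρ x) (hM0 : 0 ≤ M)
    (hM : ∀ t ∈ Ioo a b, M * (2 * ((∫ x in Ioo a t, ρ x) * ∫ x in Ioo t b, ρ x)) ≤
      ρ t * ∫ x in Ioo a b, ρ x)
    (h : IsCompetitor (Ioo a b) ρ u g) :
    M * ∫ x in Ioo a b, |u x| * ρ x ≤ ∫ x in Ioo a b, |g x| * ρ x := by
  obtain ⟨⟨hweak, huρ, hgρ⟩, hmean, -⟩ := h
  set ν := volume.restrict (Ioo a b) with hν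
  set P := ∫ x in Ioo a b, ρ x with hP
  have hmem : ∀ᵐ x ∂ν, x ∈ Ioo a b := ae_restrict_mem measurableSet_Ioo
  have hPpos : 0 < P := setIntegral_Ioo_pos hab hρ hpos
  set μ := ν.withDensity fun x => ENNReal.ofReal (ρ x) with hμ
  set γ := ν.withDensity fun x => ‖g x‖ₑ with hγ
  have hum : AEStronglyMeasurable u ν := hweak.1.aestronglyMeasurable
  have hgm : AEStronglyMeasurable g ν := hweak.2.1.aestronglyMeasurable
  have hρm : AEMeasurable (fun x => ENNReal.ofReal (ρ x)) ν := hρ.1.aemeasurable.ennreal_ofReal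
  have hμset : ∀ s, MeasurableSet s → s ⊆ Ioo a b →
      ∫⁻ x in s, ENNReal.ofReal (ρ x) = ENNReal.ofReal (∫ x in s, ρ x) := by
    intro s hs hsub
    rw [ofReal_integral_eq_lintegral_ofReal (hρ.mono_set hsub)]
    filter_upwards [ae_restrict_mem hs] with x hx using (hpos x (hsub hx)).le
  have hnorm : ∀ f : ℝ → ℝ, IntegrableOn (fun x => f x * ρ x) (Ioo a b) →
      ∫⁻ x, ENNReal.ofReal (ρ x) * ‖f x‖ₑ ∂ν = ENNReal.ofReal (∫ x in Ioo a b, |f x| * ρ x) := by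
    intro f hf
    have e : ∫ x in Ioo a b, |f x| * ρ x = ∫ x in Ioo a b, ‖f x * ρ x‖ := by
      refine setIntegral_congr_fun measurableSet_Ioo fun x hx => ?_
      simp [abs_of_pos (hpos x hx)]
    rw [e, ofReal_integral_norm_eq_lintegral_enorm hf]
    refine lintegral_congr_ae ?_
    filter_upwards [hmem] with x hx
    rw [enorm_mul, Real.enorm_of_nonneg (hpos x hx).le, mul_comm]
  have hmeanle : ∀ᵐ x ∂ν, ENNReal.ofReal P * ‖u x‖ₑ ≤ ∫⁻ z, γ (uIoc x z) ∂μ := by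
    filter_upwards [hweak.ae_ae_enorm_sub_le hab] with x hx
    -- The zero mean of `u` is used here: the term `∫ u ρ` drops out.
    have e : P * u x = ∫ z in Ioo a b, (u x - u z) * ρ z := by
      simp_rw [sub_mul]
      rw [integral_sub (hρ.const_mul _) huρ, hmean, integral_const_mul]
      ring
    calc ENNReal.ofReal P * ‖u x‖ₑ = ‖P * u x‖ₑ := by
          rw [enorm_mul, Real.enorm_of_nonneg hPpos.le]
      _ ≤ ∫⁻ z, ‖(u x - u z) * ρ z‖ₑ ∂ν := by
          rw [e]; exact enorm_integral_le_lintegral_enorm _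
      _ = ∫⁻ z, ((fun z => ENNReal.ofReal (ρ z)) * fun z => ‖u x - u z‖ₑ) z ∂ν := by
          refine lintegral_congr_ae ?_
          filter_upwards [hmem] with z hz
          rw [Pi.mul_apply, enorm_mul, Real.enorm_of_nonneg (hpos z hz).le, mul_comm]
      _ = ∫⁻ z, ‖u x - u z‖ₑ ∂μ :=
          (lintegral_withDensity_eq_lintegral_mul₀ hρm
            (aestronglyMeasurable_const.sub hum).enorm).symm
      _ ≤ ∫⁻ z, γ (uIoc x z) ∂μ :=
          lintegral_mono_ae ((withDensity_absolutelyContinuous ν _).ae_le hx)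
  have hdouble : ENNReal.ofReal P * ENNReal.ofReal (∫ x in Ioo a b, |u x| * ρ x) ≤
      2 * ∫⁻ y, μ (Iio y) * μ (Ici y) ∂γ := by
    calc _ = ENNReal.ofReal P * ∫⁻ x, ‖u x‖ₑ ∂μ := by
          rw [hμ, lintegral_withDensity_eq_lintegral_mul₀ hρm hum.enorm, ← hnorm u huρ]
          rfl
      _ = ∫⁻ x, ENNReal.ofReal P * ‖u x‖ₑ ∂μ :=
          (lintegral_const_mul' _ _ ENNReal.ofReal_ne_top).symm
      _ ≤ ∫⁻ x, ∫⁻ z, γ (uIoc x z) ∂μ ∂μ :=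
          lintegral_mono_ae ((withDensity_absolutelyContinuous ν _).ae_le hmeanle)
      _ ≤ _ := lintegral_lintegral_measure_uIoc_le μ γ
  have hIio : ∀ y ∈ Ioo a b, μ (Iio y) = ENNReal.ofReal (∫ x in Ioo a y, ρ x) := by
    intro y hy
    have hs : Iio y ∩ Ioo a b = Ioo a y := by
      ext x; simp only [mem_inter_iff, mem_Iio, mem_Ioo]
      exact ⟨fun h => ⟨h.2.1, h.1⟩, fun h => ⟨h.2, h.1, h.2.trans hy.2⟩⟩
    rw [hμ, withDensity_apply _ measurableSet_Iio, hν, Measure.restrict_restrict measurableSet_Iio,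
      hs, hμset _ measurableSet_Ioo (Ioo_subset_Ioo_right hy.2.le)]
  have hIci : ∀ y ∈ Ioo a b, μ (Ici y) = ENNReal.ofReal (∫ x in Ioo y b, ρ x) := by
    intro y hy
    have hs : Ici y ∩ Ioo a b = Ico y b := by
      ext x; simp only [mem_inter_iff, mem_Ici, mem_Ioo, mem_Ico]
      exact ⟨fun h => ⟨h.1, h.2.2⟩, fun h => ⟨h.1, hy.1.trans_le h.1, h.2⟩⟩
    rw [hμ, withDensity_apply _ measurableSet_Ici, hν, Measure.restrict_restrict measurableSet_Ici,
      hs, hμset _ measurableSet_Ico (fun x hx => ⟨hy.1.trans_le hx.1, hx.2⟩),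
      integral_Ico_eq_integral_Ioo]
  have hγle : ENNReal.ofReal M * (2 * ∫⁻ y, μ (Iio y) * μ (Ici y) ∂γ) ≤
      ENNReal.ofReal P * ENNReal.ofReal (∫ x in Ioo a b, |g x| * ρ x) := by
    have hm : Measurable fun y => μ (Iio y) * μ (Ici y) :=
      (Monotone.measurable fun _ _ h => measure_mono (Iio_subset_Iio h)).mul
        (Antitone.measurable fun _ _ h => measure_mono (Ici_subset_Ici.2 h))
    rw [hγ, lintegral_withDensity_eq_lintegral_mul₀ hgm.enorm hm.aemeasurable, ← hnorm g hgρ,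
      ← lintegral_const_mul' _ _ ENNReal.ofReal_ne_top,
      ← lintegral_const_mul' _ _ ENNReal.ofNat_ne_top,
      ← lintegral_const_mul' _ _ ENNReal.ofReal_ne_top]
    refine lintegral_mono_ae ?_
    filter_upwards [hmem] with y hy
    have hA : 0 ≤ ∫ x in Ioo a y, ρ x :=
      setIntegral_nonneg measurableSet_Ioo fun x hx => (hpos x ⟨hx.1, hx.2.trans hy.2⟩).le
    have key : ENNReal.ofReal M * (2 * (μ (Iio y) * μ (Ici y))) ≤
        ENNReal.ofReal (ρ y) * ENNReal.ofReal P := by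
      rw [hIio y hy, hIci y hy, ← ENNReal.ofReal_mul hA, ← ENNReal.ofReal_ofNat 2,
        ← ENNReal.ofReal_mul zero_le_two, ← ENNReal.ofReal_mul hM0,
        ← ENNReal.ofReal_mul (hpos y hy).le]
      exact ENNReal.ofReal_le_ofReal (hM y hy)
    calc _ = (ENNReal.ofReal M * (2 * (μ (Iio y) * μ (Ici y)))) * ‖g y‖ₑ := by
          simp only [Pi.mul_apply]; ring
      _ ≤ (ENNReal.ofReal (ρ y) * ENNReal.ofReal P) * ‖g y‖ₑ := by gcongr
      _ = _ := by ring
  have hgnonneg : 0 ≤ ∫ x in Ioo a b, |g x| * ρ x :=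
    setIntegral_nonneg measurableSet_Ioo fun x hx => mul_nonneg (abs_nonneg _) (hpos x hx).le
  have hfin : ENNReal.ofReal P * ENNReal.ofReal (M * ∫ x in Ioo a b, |u x| * ρ x) ≤
      ENNReal.ofReal P * ENNReal.ofReal (∫ x in Ioo a b, |g x| * ρ x) := by
    refine le_trans ?_ ((mul_le_mul_right hdouble _).trans hγle)
    rw [ENNReal.ofReal_mul hM0, mul_left_comm]
  rw [ENNReal.mul_le_mul_iff_right (by simpa using hPpos) ENNReal.ofReal_ne_top,
    ENNReal.ofReal_le_ofReal_iff hgnonneg] at hfin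
  exact hfin

/-! ### The exponential model weight on the unit interval. -/

theorem Real.two_mul_exp_sub_one_le {w : ℝ} (hw : 0 ≤ w) :
    2 * (Real.exp w - 1) ≤ w * (Real.exp w + 1) := by
  have hd : ∀ x, HasDerivAt (fun x => x * (Real.exp x + 1) - 2 * (Real.exp x - 1))
      (1 * (Real.exp x + 1) + x * Real.exp x - 2 * Real.exp x) x := fun x =>
    ((hasDerivAt_id' x).mul ((Real.hasDerivAt_exp x).add_const 1)).sub
      (((Real.hasDerivAt_exp x).sub_const 1).const_mul 2)
  have hmono : MonotoneOn (fun x => x * (Real.exp x + 1) - 2 * (Real.exp x - 1)) (Ici 0) := by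
    refine monotoneOn_of_deriv_nonneg (convex_Ici 0)
      (fun x _ => (hd x).continuousAt.continuousWithinAt)
      (fun x _ => (hd x).differentiableAt.differentiableWithinAt) fun x _ => ?_
    rw [(hd x).deriv]
    have h1 := Real.add_one_le_exp (-x)
    have h2 : Real.exp x * Real.exp (-x) = 1 := by rw [← Real.exp_add]; simp
    nlinarith [Real.exp_pos x]
  have := hmono self_mem_Ici hw hw
  simp only [Real.exp_zero] at this
  linarith

/-- With `X = exp(kt)`, `Y = exp(ks)` and `Z = √(XY)`, one has `1/a + 1/b = k (Z² - 1) / ((X - 1)(Y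
- 1))`. By AM-GM `(X - 1)(Y - 1) ≤ (Z - 1)²`, so the sum is at least `k (Z + 1) / (Z - 1)`. This
exceeds `k` trivially, and is at least `4` by `Real.two_mul_exp_sub_one_le` at `w = k/2`. -/
theorem harmonic_exp_of_pos {k t s a b : ℝ} (hk : 0 < k) (ht : 0 < t) (hs : 0 < s)
    (hts : t + s = 1) (ha : k * a = 1 - Real.exp (-(k * t))) (hb : k * b = Real.exp (k * s) - 1) :
    4 * (a * b) ≤ a + b ∧ k * (a * b) ≤ a + b := by
  set X := Real.exp (k * t) with hX
  set Y := Real.exp (k * s) with hY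
  set Z := Real.exp (k / 2) with hZ
  have hZZ : Z * Z = X * Y := by
    rw [hZ, hX, hY, ← Real.exp_add, ← Real.exp_add]; congr 1; linear_combination -k * hts
  have hX1 : 1 < X := Real.one_lt_exp_iff.2 (mul_pos hk ht)
  have hY1 : 1 < Y := Real.one_lt_exp_iff.2 (mul_pos hk hs)
  have hZ1 : 1 < Z := Real.one_lt_exp_iff.2 (by linarith)
  have hZk : 4 * (Z - 1) ≤ k * (Z + 1) := by
    have := Real.two_mul_exp_sub_one_le (w := k / 2) (by linarith)
    linarith
  have hXa : X * (k * a) = X - 1 := by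
    rw [ha, mul_sub, hX, ← Real.exp_add]; simp
  have hsum : 2 * Z ≤ X + Y := by
    have h : (2 * Z) ^ 2 ≤ (X + Y) ^ 2 := by nlinarith [sq_nonneg (X - Y)]
    exact le_of_sq_le_sq h (by linarith)
  have hprod : (X - 1) * (Y - 1) ≤ (Z - 1) ^ 2 := by nlinarith
  have e1 : k * (k * X) * (a * b) = (X - 1) * (Y - 1) := by
    rw [← hXa, ← hb]; ring
  have e2 : k * X * (a + b) = Z * Z - 1 := by
    rw [hZZ]; linear_combination hXa + X * hb
  have hkX : 0 < k * X := mul_pos hk (by linarith)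
  constructor
  · refine le_of_mul_le_mul_left ?_ (mul_pos hk hkX)
    have : k * (k * X) * (a + b) = k * (Z * Z - 1) := by rw [← e2]; ring
    rw [this]
    have h3 : (Z - 1) * (4 * (Z - 1)) ≤ (Z - 1) * (k * (Z + 1)) :=
      mul_le_mul_of_nonneg_left hZk (by linarith)
    nlinarith
  · refine le_of_mul_le_mul_left ?_ hkX
    rw [e2]
    have : k * X * (k * (a * b)) = (X - 1) * (Y - 1) := by rw [← e1]; ring
    rw [this]
    nlinarith

theorem setIntegral_Ioo_exp {p q : ℝ} (k t : ℝ) (hpq : p ≤ q) :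
    k * ∫ x in Ioo p q, Real.exp (k * (x - t)) =
      Real.exp (k * (q - t)) - Real.exp (k * (p - t)) := by
  rw [← integral_Ioc_eq_integral_Ioo, ← intervalIntegral.integral_of_le hpq,
    ← intervalIntegral.integral_const_mul]
  refine intervalIntegral.integral_eq_sub_of_hasDerivAt
    (f := fun x => Real.exp (k * (x - t))) (fun x _ => ?_)
    (Continuous.intervalIntegrable (by fun_prop) _ _)
  have h := (((hasDerivAt_id' x).sub_const t).const_mul k).exp
  convert! h using 1
  ring

theorem harmonic_setIntegral_exp {t : ℝ} (k : ℝ) (ht : t ∈ Ioo (0 : ℝ) 1) :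
    let a := ∫ x in Ioo 0 t, Real.exp (k * (x - t))
    let b := ∫ x in Ioo t 1, Real.exp (k * (x - t))
    4 * (a * b) ≤ a + b ∧ |k| * (a * b) ≤ a + b := by
  intro a b
  have ha := setIntegral_Ioo_exp k t ht.1.le
  have hb := setIntegral_Ioo_exp k t ht.2.le
  rw [sub_self, mul_zero, Real.exp_zero] at ha hb
  have hs : 0 < 1 - t := sub_pos.2 ht.2
  rcases lt_trichotomy k 0 with hk | rfl | hk
  · have := harmonic_exp_of_pos (k := -k) (t := 1 - t) (s := t) (a := b) (b := a) (by linarith) hs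
      ht.1 (by ring) (by rw [neg_mul, hb]; simp) (by rw [neg_mul, ha]; simp)
    rw [abs_of_neg hk, mul_comm a b, add_comm a b]
    exact this
  · have ea : a = t := by simp [a, ht.1.le]
    have eb : b = 1 - t := by simp [b, ht.2.le]
    rw [ea, eb, abs_zero]
    constructor <;> nlinarith [sq_nonneg (2 * t - 1)]
  · rw [abs_of_pos hk]
    exact harmonic_exp_of_pos hk ht.1 hs (by ring) (by rw [ha]; simp) hb

/-! ### Comparison with the model, and the gain from missing mass. -/

theorem mul_le_add_of_le_mul {A B a b r L : ℝ} (hA : 0 < A) (hB : 0 < B) (hr : 0 < r)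
    (hAa : A ≤ r * a) (hBb : B ≤ r * b) (hL : L * (a * b) ≤ a + b) :
    L * (A * B) ≤ r * (A + B) := by
  have ha : 0 < a := pos_of_mul_pos_right (hA.trans_le hAa) hr.le
  have hb : 0 < b := pos_of_mul_pos_right (hB.trans_le hBb) hr.le
  have h1 : L ≤ 1 / a + 1 / b := by
    rw [div_add_div _ _ ha.ne' hb.ne', le_div_iff₀ (mul_pos ha hb)]
    linarith
  have h2 : 1 / a ≤ r / A := by rw [div_le_div_iff₀ ha hA]; linarith
  have h3 : 1 / b ≤ r / B := by rw [div_le_div_iff₀ hb hB]; linarith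
  have h4 : L ≤ r / A + r / B := by linarith
  rw [div_add_div _ _ hA.ne' hB.ne', le_div_iff₀ (mul_pos hA hB)] at h4
  linarith

/-- Removing mass `d` from `b` raises its reciprocal by `d / (b (b - d)) ≥ d / K² ≥ ε`. -/
theorem harmonic_gain {a b d K ε : ℝ} (ha : 0 < a) (hd : 0 ≤ d) (hbd : 0 < b - d) (hbK : b ≤ K)
    (hab : 4 * (a * b) ≤ a + b) (hε0 : 0 ≤ ε) (hε : ε * K ^ 2 ≤ d) :
    (4 + ε) * (a * (b - d)) ≤ a + (b - d) := by
  have hb : 0 < b := by linarith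
  have hbb : ε * (b * (b - d)) ≤ d := by
    refine le_trans (mul_le_mul_of_nonneg_left ?_ hε0) hε
    nlinarith
  refine le_of_mul_le_mul_left ?_ hb
  nlinarith [mul_le_mul_of_nonneg_left hab hbd.le, mul_le_mul_of_nonneg_left hbb ha.le]

theorem setIntegral_Ioo_le_sub {f G : ℝ → ℝ} {p q p' q' η : ℝ} (hf : IntegrableOn f (Ioo p q))
    (hG : IntegrableOn G (Ioo p q)) (hp : p ≤ p') (hpq : p' ≤ q') (hq : q' ≤ q)
    (hfG : ∀ x ∈ Ioo p q, f x ≤ G x) (hfG' : ∀ x ∈ Ioo p' q', f x ≤ G x - η) :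
    ∫ x in Ioo p q, f x ≤ (∫ x in Ioo p q, G x) - (q' - p') * η := by
  have hsub : Ioo p' q' ⊆ Ioo p q := Ioo_subset_Ioo hp hq
  have hind : IntegrableOn ((Ioo p' q').indicator fun _ => η) (Ioo p q) :=
    (integrableOn_const (by simp) : IntegrableOn (fun _ : ℝ => η) (Ioo p q)).indicator
      measurableSet_Ioo
  calc ∫ x in Ioo p q, f x ≤ ∫ x in Ioo p q, (G x - (Ioo p' q').indicator (fun _ => η) x) := by
        refine setIntegral_mono_on hf (hG.sub hind) measurableSet_Ioo fun x hx => ?_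
        by_cases hx' : x ∈ Ioo p' q'
        · simpa [hx'] using hfG' x hx'
        · simpa [hx'] using hfG x hx
    _ = _ := by
        rw [integral_sub hG hind, setIntegral_indicator measurableSet_Ioo,
          inter_eq_self_of_subset_right hsub, setIntegral_const]
        simp [hpq]

theorem setIntegral_Ioo_le_const {G : ℝ → ℝ} {p q K : ℝ} (hpq : p ≤ q)
    (hG : IntegrableOn G (Ioo p q)) (h : ∀ x ∈ Ioo p q, G x ≤ K) :
    ∫ x in Ioo p q, G x ≤ (q - p) * K := by
  refine (setIntegral_mono_on hG (integrableOn_const (by simp)) measurableSet_Ioo h).trans_eq ?_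
  simp [hpq]

theorem setIntegral_Ioo_add {ρ : ℝ → ℝ} {p t q : ℝ} (ht : t ∈ Ioo p q)
    (hρ : IntegrableOn ρ (Ioo p q)) :
    ∫ x in Ioo p q, ρ x = (∫ x in Ioo p t, ρ x) + ∫ x in Ioo t q, ρ x := by
  rw [← integral_Ico_eq_integral_Ioo (x := t), ← setIntegral_union _ measurableSet_Ico
    (hρ.mono_set (Ioo_subset_Ioo_right ht.2.le)) (hρ.mono_set fun x hx => ⟨ht.1.trans_le hx.1, hx.2⟩),
    Ioo_union_Ico_eq_Ioo ht.1 ht.2.le]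
  exact disjoint_left.2 fun x hx hx' => absurd hx.2 (not_lt.2 hx'.1)

theorem exp_sub_le_exp_sub {z y c : ℝ} (hz : -5 ≤ z) (hc : 0 ≤ c) (hcy : c ≤ y) (hc1 : c ≤ 1) :
    Real.exp (z - y) ≤ Real.exp z - Real.exp (-5) * (c / 2) := by
  have h1 : Real.exp (-y) ≤ 1 - c / 2 := by
    refine (Real.exp_le_exp.2 (neg_le_neg hcy)).trans ?_
    rw [Real.exp_neg, inv_le_comm₀ (Real.exp_pos _) (by linarith)]
    refine le_trans ?_ (Real.add_one_le_exp c)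
    rw [inv_le_iff_one_le_mul₀ (by linarith)]
    nlinarith
  have h2 : Real.exp (-5) ≤ Real.exp z := Real.exp_le_exp.2 hz
  rw [sub_eq_add_neg, Real.exp_add]
  nlinarith [mul_le_mul_of_nonneg_left h1 (Real.exp_pos z).le]

/-- A weight lying below an exponential that touches it at `t`, with a Gaussian gain on
`[1/10, 9/10]`, satisfies an improved isoperimetric inequality at `t`. -/
theorem isoperimetric_of_exp_bound {ρ : ℝ → ℝ} {t k c : ℝ} (ht : t ∈ Ioo (0 : ℝ) 1)
    (hρ : IntegrableOn ρ (Ioo 0 1)) (hpos : ∀ x ∈ Ioo (0 : ℝ) 1, 0 < ρ x) (hc0 : 0 ≤ c)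
    (hc : c ≤ 2) (hk : ∀ x ∈ Ioo (0 : ℝ) 1, ρ x ≤ ρ t * Real.exp (k * (x - t)))
    (hJ : t ∈ Icc (1 / 10 : ℝ) (1 - 1 / 10) → ∀ x ∈ Icc (1 / 10 : ℝ) (1 - 1 / 10),
      ρ x ≤ ρ t * Real.exp (k * (x - t) - c / 4 * (x - t) ^ 2)) :
    (2 + Real.exp (-15) / 8000 * c) * (2 * ((∫ x in Ioo 0 t, ρ x) * ∫ x in Ioo t 1, ρ x)) ≤
      ρ t * ∫ x in Ioo 0 1, ρ x := by
  have hr : 0 < ρ t := hpos t ht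
  have hsub₁ : Ioo 0 t ⊆ Ioo (0 : ℝ) 1 := Ioo_subset_Ioo_right ht.2.le
  have hsub₂ : Ioo t 1 ⊆ Ioo (0 : ℝ) 1 := Ioo_subset_Ioo_left ht.1.le
  have hρ₁ := hρ.mono_set hsub₁
  have hρ₂ := hρ.mono_set hsub₂
  have hA := setIntegral_Ioo_pos ht.1 hρ₁ fun x hx => hpos x (hsub₁ hx)
  have hB := setIntegral_Ioo_pos ht.2 hρ₂ fun x hx => hpos x (hsub₂ hx)
  have hG : ∀ p q : ℝ, IntegrableOn (fun x => Real.exp (k * (x - t))) (Ioo p q) := fun p q =>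
    (Continuous.integrableOn_Icc (by fun_prop)).mono_set Ioo_subset_Icc_self
  have hbound : ∀ p q p' q' η : ℝ, IntegrableOn ρ (Ioo p q) → Ioo p q ⊆ Ioo 0 1 → p ≤ p' →
      p' ≤ q' → q' ≤ q → (∀ x ∈ Ioo p' q', ρ x ≤ ρ t * (Real.exp (k * (x - t)) - η)) →
      ∫ x in Ioo p q, ρ x ≤
        ρ t * ((∫ x in Ioo p q, Real.exp (k * (x - t))) - (q' - p') * η) := by
    intro p q p' q' η hi hs h1 h2 h3 h4
    have := setIntegral_Ioo_le_sub (η := ρ t * η) hi ((hG p q).const_mul (ρ t)) h1 h2 h3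
      (fun x hx => hk x (hs hx)) (fun x hx => (h4 x hx).trans_eq (mul_sub _ _ _))
    rw [integral_const_mul] at this
    linarith
  -- A degenerate subinterval with `η = 0` leaves the plain comparison with the exponential.
  have hA' := hbound 0 t 0 0 0 hρ₁ hsub₁ le_rfl le_rfl ht.1.le (by simp)
  have hB' := hbound t 1 t t 0 hρ₂ hsub₂ le_rfl le_rfl ht.2.le (by simp)
  rw [mul_zero, sub_zero] at hA' hB'
  obtain ⟨h4, hkab⟩ := harmonic_setIntegral_exp k ht
  have hGpos : ∀ p q : ℝ, p < q → 0 < ∫ x in Ioo p q, Real.exp (k * (x - t)) := fun p q hpq =>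
    setIntegral_Ioo_pos hpq (hG p q) fun x _ => Real.exp_pos _
  have ha := hGpos 0 t ht.1
  have hb := hGpos t 1 ht.2
  rw [setIntegral_Ioo_add ht hρ]
  set A := ∫ x in Ioo 0 t, ρ x
  set B := ∫ x in Ioo t 1, ρ x
  set a := ∫ x in Ioo 0 t, Real.exp (k * (x - t)) with ha_def
  set b := ∫ x in Ioo t 1, Real.exp (k * (x - t)) with hb_def
  set ε := Real.exp (-15) / 8000 * (2 * c) with hε
  have hε0 : 0 ≤ ε := by positivity
  have he15 : Real.exp (-15) ≤ 1 := Real.exp_le_one_iff.2 (by norm_num)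
  have hε1 : ε ≤ 1 := by
    rw [hε]; nlinarith [Real.exp_pos (-15)]
  rw [show (2 + Real.exp (-15) / 8000 * c) * (2 * (A * B)) = (4 + ε) * (A * B) by rw [hε]; ring]
  have hab : 0 < a * b := mul_pos ha hb
  -- A steep exponential has reciprocal sum at least `|k| ≥ 5 ≥ 4 + ε`.
  by_cases hk5 : 5 ≤ |k|
  · refine mul_le_add_of_le_mul hA hB hr hA' hB' (le_trans ?_ hkab)
    exact mul_le_mul_of_nonneg_right (by linarith) hab.le
  have hk5' := abs_lt.1 (not_le.1 hk5)
  have hexp_half : Real.exp (1 / 2) ≤ 2 := by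
    have h1 : Real.exp (1 / 2) * Real.exp (1 / 2) = Real.exp 1 := by rw [← Real.exp_add]; norm_num
    nlinarith [Real.exp_one_lt_d9, Real.exp_pos (1 / 2)]
  rcases lt_or_ge t (1 / 10) with ht₁ | ht₁
  -- The exponent is at most `1/2` on the short side, so its mass is at most `2t < 1/5` and its
  -- reciprocal alone exceeds `5`.
  · have : a ≤ (t - 0) * 2 := setIntegral_Ioo_le_const ht.1.le (hG _ _) fun x hx =>
      (Real.exp_le_exp.2 (by nlinarith [hx.1, hx.2])).trans hexp_half
    refine mul_le_add_of_le_mul hA hB hr hA' hB' ?_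
    nlinarith
  rcases lt_or_ge (1 - 1 / 10) t with ht₂ | ht₂
  · have : b ≤ (1 - t) * 2 := setIntegral_Ioo_le_const ht.2.le (hG _ _) fun x hx =>
      (Real.exp_le_exp.2 (by nlinarith [hx.1, hx.2])).trans hexp_half
    refine mul_le_add_of_le_mul hA hB hr hA' hB' ?_
    nlinarith
  have hK : ∀ x ∈ Ioo (0 : ℝ) 1, -5 ≤ k * (x - t) ∧ k * (x - t) ≤ 5 := fun x hx => by
    have h1 : |x - t| ≤ 1 := abs_le.2 ⟨by linarith [hx.1, ht.2], by linarith [hx.2, ht.1]⟩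
    have h2 : |k * (x - t)| ≤ 5 := by
      rw [abs_mul]; nlinarith [abs_nonneg k, abs_nonneg (x - t)]
    exact abs_le.1 h2
  have hgain : ∀ x ∈ Icc (1 / 10 : ℝ) (1 - 1 / 10), 1 / 10 ≤ |x - t| →
      ρ x ≤ ρ t * (Real.exp (k * (x - t)) - Real.exp (-5) * (c / 400 / 2)) := by
    intro x hx hxt
    refine (hJ ⟨ht₁, ht₂⟩ x hx).trans (mul_le_mul_of_nonneg_left ?_ hr.le)
    refine exp_sub_le_exp_sub (hK x ⟨by linarith [hx.1], by linarith [hx.2]⟩).1 (by positivity)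
      ?_ (by linarith)
    have : (1 / 10 : ℝ) ^ 2 ≤ (x - t) ^ 2 := by
      rw [← sq_abs (x - t)]; gcongr
    nlinarith
  have hd0 : 0 ≤ 3 / 10 * (Real.exp (-5) * (c / 400 / 2)) := by positivity
  -- This fixes the constant: `exp(-15)` pays for the lower bound `exp(-5)` on the exponential and
  -- for the squared mass bound `exp(5)`, and `8000` leaves `2/8000 ≤ 3/8000`.
  have hεd : ε * Real.exp 5 ^ 2 ≤ 3 / 10 * (Real.exp (-5) * (c / 400 / 2)) := by
    have h1 : Real.exp (-15) * Real.exp 5 ^ 2 = Real.exp (-5) := by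
      rw [pow_two, ← Real.exp_add, ← Real.exp_add]; norm_num
    have h2 : ε * Real.exp 5 ^ 2 = Real.exp (-5) * (2 * c) / 8000 := by
      rw [← h1, hε]; ring
    rw [h2]
    nlinarith [mul_nonneg (Real.exp_pos (-5)).le hc0]
  rcases le_total t (1 / 2) with hth | hth
  -- This interval of length `3/10` stays at distance at least `1/10` from every `t ≤ 1/2`; the
  -- other case is its mirror image.
  · have hB'' := hbound t 1 (6 / 10) (9 / 10) (Real.exp (-5) * (c / 400 / 2)) hρ₂ hsub₂
      (by linarith) (by norm_num) (by norm_num) fun x hx =>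
        hgain x ⟨by linarith [hx.1], by linarith [hx.2]⟩ (le_abs.2 (Or.inl (by linarith [hx.1])))
    rw [← hb_def, show (9 / 10 - 6 / 10 : ℝ) = 3 / 10 by norm_num] at hB''
    have hbK : b ≤ Real.exp 5 := by
      have : b ≤ (1 - t) * Real.exp 5 := setIntegral_Ioo_le_const ht.2.le (hG _ _) fun x hx =>
        Real.exp_le_exp.2 (hK x (hsub₂ hx)).2
      nlinarith [Real.exp_pos 5, ht.1]
    exact mul_le_add_of_le_mul hA hB hr hA' hB'' (harmonic_gain ha hd0
      (pos_of_mul_pos_right (hB.trans_le hB'') hr.le) hbK h4 hε0 hεd)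
  · have hA'' := hbound 0 t (1 / 10) (4 / 10) (Real.exp (-5) * (c / 400 / 2)) hρ₁ hsub₁
      (by linarith) (by norm_num) (by linarith) fun x hx =>
        hgain x ⟨by linarith [hx.1], by linarith [hx.2]⟩ (le_abs.2 (Or.inr (by linarith [hx.2])))
    rw [← ha_def, show (4 / 10 - 1 / 10 : ℝ) = 3 / 10 by norm_num] at hA''
    have haK : a ≤ Real.exp 5 := by
      have : a ≤ (t - 0) * Real.exp 5 := setIntegral_Ioo_le_const ht.1.le (hG _ _) fun x hx =>
        Real.exp_le_exp.2 (hK x (hsub₁ hx)).2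
      nlinarith [Real.exp_pos 5, ht.2]
    rw [mul_comm A B, add_comm A B]
    exact mul_le_add_of_le_mul hB hA hr hB' hA'' (harmonic_gain hb hd0
      (pos_of_mul_pos_right (hA.trans_le hA'') hr.le) haK (by linarith) hε0 hεd)

/-! ### Exponential majorants of concave and power-concave functions. -/

theorem ConcaveOn.exists_supergradient {S : Set ℝ} {f : ℝ → ℝ} {t : ℝ} (hf : ConcaveOn ℝ S f)
    (ht : t ∈ interior S) : ∃ κ, ∀ x ∈ S, f x ≤ f t + κ * (x - t) := by
  refine ⟨-derivWithin (-f) (Ioi t) t, fun x hx => ?_⟩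
  rcases lt_trichotomy x t with h | rfl | h
  · have h1 := (hf.neg.slope_le_leftDeriv_of_mem_interior hx ht h).trans
      (hf.neg.leftDeriv_le_rightDeriv_of_mem_interior ht)
    rw [slope_def_field, div_le_iff₀ (sub_pos.2 h)] at h1
    simp only [Pi.neg_apply] at h1
    linarith
  · simp
  · have h1 := hf.neg.rightDeriv_le_slope_of_mem_interior ht hx h
    rw [slope_def_field, le_div_iff₀ (sub_pos.2 h)] at h1
    simp only [Pi.neg_apply] at h1
    linarith

theorem ConcaveOn.exists_le_mul_exp {S : Set ℝ} {f : ℝ → ℝ} {t : ℝ} (hf : ConcaveOn ℝ S f)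
    (ht : t ∈ interior S) (hpos : 0 < f t) :
    ∃ k, ∀ x ∈ S, f x ≤ f t * Real.exp (k * (x - t)) := by
  obtain ⟨κ, hκ⟩ := hf.exists_supergradient ht
  refine ⟨κ / f t, fun x hx => (hκ x hx).trans ?_⟩
  calc f t + κ * (x - t) = f t * (κ / f t * (x - t) + 1) := by field_simp; ring
    _ ≤ _ := mul_le_mul_of_nonneg_left (Real.add_one_le_exp _) hpos.le

theorem IsPositivePowerConcaveOn.eq_pow {m : ℕ} {S : Set ℝ} {f : ℝ → ℝ} (hm : m ≠ 0)
    (hf : IsPositivePowerConcaveOn m S f) {x : ℝ} (hx : x ∈ S) :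
    f x = (f x ^ (1 / (m : ℝ))) ^ m := by
  rw [one_div, Real.rpow_inv_natCast_pow (hf.1 x hx).le hm]

theorem IsPositivePowerConcaveOn.exists_le_mul_exp {m : ℕ} {S : Set ℝ} {f : ℝ → ℝ} {t : ℝ}
    (hm : m ≠ 0) (hf : IsPositivePowerConcaveOn m S f) (ht : t ∈ interior S) :
    ∃ k, ∀ x ∈ S, f x ≤ f t * Real.exp (k * (x - t)) := by
  have htS := interior_subset ht
  obtain ⟨k, hk⟩ := hf.2.exists_le_mul_exp ht (Real.rpow_pos_of_pos (hf.1 t htS) _)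
  refine ⟨m * k, fun x hx => ?_⟩
  rw [hf.eq_pow hm hx, hf.eq_pow hm htS, mul_assoc, Real.exp_nat_mul, ← mul_pow]
  exact pow_le_pow_left₀ (Real.rpow_nonneg (hf.1 x hx).le _) (hk x hx) m

theorem IsPositivePowerConcaveOn.continuousOn {m : ℕ} {S : Set ℝ} {f : ℝ → ℝ} (hm : m ≠ 0)
    (hS : IsOpen S) (hf : IsPositivePowerConcaveOn m S f) : ContinuousOn f S :=
  ((hf.2.continuousOn hS).pow m).congr fun _ hx => hf.eq_pow hm hx

/-! ### The Gaussian gain for affine functions. -/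

/-- With `s = √(1 + z)`, the bound `s ≤ exp(s - 1)` squares to `1 + z ≤ exp(z - (s - 1)²)`, so `q ≤
(s - 1)² = z² / (s + 1)²` suffices. The first hypothesis gives this when `s ≤ 1`, the second when `s
≥ 1`, since then `s + 1 ≤ 2 s²`. -/
theorem one_add_le_exp_sub {z q : ℝ} (hz : 0 < 1 + z) (h₁ : 4 * q ≤ z ^ 2)
    (h₂ : 4 * q * (1 + z) ^ 2 ≤ z ^ 2) : 1 + z ≤ Real.exp (z - q) := by
  set s := √(1 + z) with hs
  have hs0 : 0 < s := Real.sqrt_pos.2 hz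
  have hss : s ^ 2 = 1 + z := Real.sq_sqrt hz.le
  have hzs : z = (s - 1) * (s + 1) := by linear_combination -hss
  have hq : q ≤ (s - 1) ^ 2 := by
    rcases le_total s 1 with h | h
    · have : (s + 1) ^ 2 ≤ 2 ^ 2 := by gcongr; linarith
      rw [hzs, mul_pow] at h₁
      nlinarith [sq_nonneg (s - 1)]
    · have h3 : (s + 1) ^ 2 ≤ 4 * (s ^ 2) ^ 2 := by nlinarith [mul_self_nonneg (s ^ 2 - s)]
      have h4 : 4 * q * (s ^ 2) ^ 2 ≤ 4 * (s - 1) ^ 2 * (s ^ 2) ^ 2 := by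
        rw [← hss, hzs, mul_pow] at h₂
        refine h₂.trans ?_
        nlinarith [sq_nonneg (s - 1)]
      have := le_of_mul_le_mul_right h4 (by positivity)
      linarith
  have h5 : s ≤ Real.exp (s - 1) := by linarith [Real.add_one_le_exp (s - 1)]
  calc 1 + z = s ^ 2 := hss.symm
    _ ≤ Real.exp (s - 1) ^ 2 := by gcongr
    _ = Real.exp (2 * (s - 1)) := by rw [← Real.exp_nat_mul]; norm_num
    _ ≤ Real.exp (z - q) := Real.exp_le_exp.2 (by nlinarith)

/-- A supergradient at the midpoint of `[p, q]`, tested at both endpoints, must have slope `α`. -/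
theorem ConcaveOn.le_affine_of_eqOn {S : Set ℝ} {h : ℝ → ℝ} {p q α β : ℝ} (hh : ConcaveOn ℝ S h)
    (hpq : p < q) (hJ : Icc p q ⊆ S) (haff : ∀ x ∈ Icc p q, h x = α * x + β) {x : ℝ}
    (hx : x ∈ S) : h x ≤ α * x + β := by
  have hmid : (p + q) / 2 ∈ Ioo p q := ⟨by linarith, by linarith⟩
  obtain ⟨κ, hκ⟩ := hh.exists_supergradient (t := (p + q) / 2)
    (interior_mono hJ (by rwa [interior_Icc]))
  have h0 := haff _ (Ioo_subset_Icc_self hmid)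
  have hp := hκ p (hJ (left_mem_Icc.2 hpq.le))
  have hq := hκ q (hJ (right_mem_Icc.2 hpq.le))
  rw [haff p (left_mem_Icc.2 hpq.le), h0] at hp
  rw [haff q (right_mem_Icc.2 hpq.le), h0] at hq
  have : κ = α := by nlinarith
  have := hκ x hx
  rw [h0] at this
  subst κ
  linarith

theorem affine_le_mul_exp {α β t x c : ℝ} (ht : 0 < α * t + β) (hx : 0 < α * x + β)
    (hct : c ≤ (α / (α * t + β)) ^ 2) (hcx : c ≤ (α / (α * x + β)) ^ 2) :
    α * x + β ≤
      (α * t + β) * Real.exp (α / (α * t + β) * (x - t) - c / 4 * (x - t) ^ 2) := by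
  set H := α * t + β with hH
  have e : 1 + α / H * (x - t) = (α * x + β) / H := by field_simp; rw [hH]; ring
  have e' : α * x + β = H * (1 + α / H * (x - t)) := by rw [e]; field_simp
  have hz := one_add_le_exp_sub (z := α / H * (x - t)) (q := c / 4 * (x - t) ^ 2)
    (by rw [e]; positivity)
    (by rw [mul_pow]; nlinarith [mul_le_mul_of_nonneg_right hct (sq_nonneg (x - t))]) (by
      have h1 : (α / (α * x + β)) ^ 2 * ((α * x + β) / H) ^ 2 = (α / H) ^ 2 := by
        field_simp
      rw [e, mul_pow (α / H), ← h1]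
      have h2 := mul_le_mul_of_nonneg_right hcx
        (mul_nonneg (sq_nonneg (x - t)) (sq_nonneg ((α * x + β) / H)))
      linarith)
  rw [e']
  exact mul_le_mul_of_nonneg_left hz ht.le

/-- At the endpoint where the positive affine function is larger, its value is at least `|α| (q -
p)`. -/
theorem sq_div_affine_le {α β p q c : ℝ} (hpq : p < q) (hp : 0 < α * p + β) (hq : 0 < α * q + β)
    (hcp : c ≤ (α / (α * p + β)) ^ 2) (hcq : c ≤ (α / (α * q + β)) ^ 2) :
    c ≤ (1 / (q - p)) ^ 2 := by
  have hqp : 0 < q - p := sub_pos.2 hpq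
  rcases le_total 0 α with hα | hα
  · refine hcq.trans (pow_le_pow_left₀ (by positivity) ?_ 2)
    rw [div_le_div_iff₀ hq hqp]
    linarith
  · refine hcp.trans ?_
    rw [← neg_sq, ← neg_div]
    refine pow_le_pow_left₀ (div_nonneg (by linarith) hp.le) ?_ 2
    rw [div_le_div_iff₀ hp hqp]
    linarith

theorem derivWithin_eq_of_eqOn_affine {h : ℝ → ℝ} {p q α β : ℝ} (hpq : p < q)
    (haff : ∀ x ∈ Icc p q, h x = α * x + β) {x : ℝ} (hx : x ∈ Icc p q) :
    derivWithin h (Icc p q) x = α := by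
  have hd : HasDerivWithinAt (fun x => α * x + β) α (Icc p q) x := by
    simpa using (((hasDerivAt_id' x).const_mul α).add_const β).hasDerivWithinAt
  exact (hd.congr haff (haff x hx)).derivWithin (uniqueDiffOn_Icc hpq x hx)

/-! ### Assembly of the proposition. -/

theorem proposition3p3 (m : ℕ) (hm : m ≠ 0) :
    ∃ C₁ δ₀ : ℝ, 0 < C₁ ∧ 0 < δ₀ ∧ δ₀ < 1 / 2 ∧
      ∀ ρ φ h : ℝ → ℝ,
        (∀ x ∈ Ioo (0 : ℝ) 1, ρ x = φ x * h x) →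
        (∀ x ∈ Ioo (0 : ℝ) 1, 0 < ρ x) →
        eLpNorm ρ ⊤ (volume.restrict (Ioo (0 : ℝ) 1)) = 1 →
        IsPositivePowerConcaveOn m (Ioo 0 1) φ →
        ConcaveOn ℝ (Ioo 0 1) h →
        IsAffineOn (Icc δ₀ (1 - δ₀)) h →
        sigmaOne (Ioo 0 1) ρ ≤ ((5 / 2 : ℝ) : EReal) →
        ∃ c : ℝ,
          IsLeast ((fun x => (derivWithin h (Icc δ₀ (1 - δ₀)) x / h x) ^ 2) ''
            Icc δ₀ (1 - δ₀)) c ∧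
          ((2 + C₁ * c : ℝ) : EReal) ≤ sigmaOne (Ioo 0 1) ρ := by
  refine ⟨Real.exp (-15) / 8000, 1 / 10, by positivity, by norm_num, by norm_num, ?_⟩
  rintro ρ φ h hρφ hpos hnorm hφ hh ⟨α, β, haff⟩ -
  have hJ : Icc (1 / 10 : ℝ) (1 - 1 / 10) ⊆ Ioo 0 1 := Icc_subset_Ioo (by norm_num) (by norm_num)
  have hlt : (1 / 10 : ℝ) < 1 - 1 / 10 := by norm_num
  have hhpos : ∀ x ∈ Ioo (0 : ℝ) 1, 0 < h x := fun x hx =>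
    pos_of_mul_pos_right (hρφ x hx ▸ hpos x hx) (hφ.1 x hx).le
  have haffpos : ∀ x ∈ Icc (1 / 10 : ℝ) (1 - 1 / 10), 0 < α * x + β := fun x hx =>
    haff x hx ▸ hhpos x (hJ hx)
  have hρc : ContinuousOn ρ (Ioo 0 1) :=
    ((hφ.continuousOn hm isOpen_Ioo).mul (hh.continuousOn isOpen_Ioo)).congr hρφ
  have hρi : IntegrableOn ρ (Ioo 0 1) := by
    have : MemLp ρ ⊤ (volume.restrict (Ioo (0 : ℝ) 1)) :=
      ⟨hρc.aestronglyMeasurable measurableSet_Ioo, by rw [hnorm]; exact ENNReal.one_lt_top⟩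
    exact this.integrable le_top
  have hquot : EqOn (fun x => (derivWithin h (Icc (1 / 10 : ℝ) (1 - 1 / 10)) x / h x) ^ 2)
      (fun x => (α / (α * x + β)) ^ 2) (Icc (1 / 10 : ℝ) (1 - 1 / 10)) := fun x hx => by
    simp only [derivWithin_eq_of_eqOn_affine hlt haff hx, haff x hx]
  rw [hquot.image_eq]
  obtain ⟨c, hc⟩ := (isCompact_Icc.image_of_continuousOn
    (f := fun x => (α / (α * x + β)) ^ 2) (s := Icc (1 / 10 : ℝ) (1 - 1 / 10))
    ((continuousOn_const.div (by fun_prop) fun x hx => (haffpos x hx).ne').pow 2)).exists_isLeast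
    ((nonempty_Icc.2 hlt.le).image _)
  refine ⟨c, hc, ?_⟩
  have hcle : ∀ x ∈ Icc (1 / 10 : ℝ) (1 - 1 / 10), c ≤ (α / (α * x + β)) ^ 2 := fun x hx =>
    hc.2 (mem_image_of_mem _ hx)
  have hc0 : 0 ≤ c := by
    obtain ⟨x, -, rfl⟩ := hc.1
    positivity
  have hc2 : c ≤ 2 := by
    have hl := left_mem_Icc.2 hlt.le
    have hr := right_mem_Icc.2 hlt.le
    refine (sq_div_affine_le hlt (haffpos _ hl) (haffpos _ hr) (hcle _ hl) (hcle _ hr)).trans ?_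
    norm_num
  have hiso : ∀ t ∈ Ioo (0 : ℝ) 1, (2 + Real.exp (-15) / 8000 * c) *
      (2 * ((∫ x in Ioo 0 t, ρ x) * ∫ x in Ioo t 1, ρ x)) ≤ ρ t * ∫ x in Ioo 0 1, ρ x := by
    intro t ht
    have hti : t ∈ interior (Ioo (0 : ℝ) 1) := by rwa [interior_Ioo]
    obtain ⟨k, hk⟩ := hφ.exists_le_mul_exp hm hti
    -- The global and the improved bound must share one slope `l`. For `t` in the affine piece this
    -- is the logarithmic derivative of `h` at `t`, and the affine extension dominates `h` on all of
    -- `I`.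
    obtain ⟨l, hl, hlJ⟩ : ∃ l, (∀ x ∈ Ioo (0 : ℝ) 1, h x ≤ h t * Real.exp (l * (x - t))) ∧
        (t ∈ Icc (1 / 10 : ℝ) (1 - 1 / 10) → ∀ x ∈ Icc (1 / 10 : ℝ) (1 - 1 / 10),
          h x ≤ h t * Real.exp (l * (x - t) - c / 4 * (x - t) ^ 2)) := by
      by_cases htJ : t ∈ Icc (1 / 10 : ℝ) (1 - 1 / 10)
      · have hH := haffpos t htJ
        refine ⟨α / (α * t + β), fun x hx => ?_, fun _ x hx => ?_⟩
        · rw [haff t htJ]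
          calc h x ≤ α * x + β := hh.le_affine_of_eqOn hlt hJ haff hx
            _ = (α * t + β) * (α / (α * t + β) * (x - t) + 1) := by
                field_simp; ring
            _ ≤ _ := mul_le_mul_of_nonneg_left (Real.add_one_le_exp _) hH.le
        · rw [haff t htJ, haff x hx]
          exact affine_le_mul_exp hH (haffpos x hx) (hcle t htJ) (hcle x hx)
      · obtain ⟨l, hl⟩ := hh.exists_le_mul_exp hti (hhpos t ht)
        exact ⟨l, hl, fun h' => absurd h' htJ⟩
    refine isoperimetric_of_exp_bound (k := k + l) ht hρi hpos hc0 hc2 (fun x hx => ?_)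
      fun htJ x hx => ?_
    · rw [hρφ x hx, hρφ t ht, add_mul, Real.exp_add, mul_mul_mul_comm]
      exact mul_le_mul (hk x hx) (hl x hx) (hhpos x hx).le
        (mul_nonneg (hφ.1 t ht).le (Real.exp_pos _).le)
    · rw [hρφ x (hJ hx), hρφ t ht, add_mul, add_sub_assoc, Real.exp_add, mul_mul_mul_comm]
      exact mul_le_mul (hk x (hJ hx)) (hlJ htJ x hx) (hhpos x (hJ hx)).le
        (mul_nonneg (hφ.1 t ht).le (Real.exp_pos _).le)
  refine le_iInf fun u => le_iInf fun g => le_iInf fun hcomp => EReal.coe_le_coe_iff.2 ?_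
  rw [le_div_iff₀ hcomp.2.2]
  exact hcomp.mul_integral_abs_le one_pos hρi hpos (by positivity) hiso
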